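/- **Setting.** Let $\mathcal X$ be a measurable space, $\mathcal Y$ a set, $c\ge 1$, and let $\ell:\mathcal Y^2\to\mathbb R_{\ge 0}$ be a $c$-approximate pseudo-metric: $\ell(y,y)=0$, $\ell(y_1,y_2)=\ell(y_2,y_1)$ and $\ell(y_1,y_2)\le c\,(\ell(y_1,y_3)+\ell(y_2,y_3))$ for all labels. Let $\mathcal H\subseteq\mathcal Y^{\mathcal X}$ be admissible (image admissible Suslin): there are a standard Borel space $T$ and a surjection $t\mapsto h_t$ from $T$ onto $\mathcal H$ such that for every $s\in T$ the function $(t,x)\mapsto \ell(h_t(x),h_s(x))$ and the set $\{(t,x): h_t(x)=h_s(x)\}$ are measurable on $T\times\mathcal X$. **Graph dimension.** A sample $(x_1,\dots,x_n)\in\mathcal X^n$ is $\gamma$-graph shattered by $\mathcal H$ if there is $f:[n]\to\mathcal Y$ such that for every $b\in\{0,1\}^n$ there is $h_b\in\mathcal H$ with $h_b(x_i)=f(i)$ whenever $b_i=0$ and $\ell(h_b(x_i),f(i))>\gamma$ whenever $b_i=1$. The $\gamma$-graph dimension $\mathbb D^{\mathrm G}_\gamma(\mathcal H)\in\mathbb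 N\cup\{\infty\}$ is the supremum of the sizes $n$ of $\gamma$-graph shattered samples. **Learning.** A learner $A$ maps every labelled sample of any size $n$ to a function $\mathcal X\to\mathcal Y$. It is an ERM for $\mathcal H$ if on every realizable sample $((x_i,y_i))_{i\le n}$ (that is, some $h\in\mathcal H$ has $h(x_i)=y_i$ for all $i$) it returns a member of $\mathcal H$ that fits all labels, $A(S)(x_i)=y_i$ for all $i$. (If $\ell(y,y')=0$ only for $y=y'$, this says that the empirical loss is $0$.) For a target $h^\star\in\mathcal H$ and a probability distribution $\mathcal D$ on $\mathcal X$, the sample $S$ consists of $n$ i.i.d. points of law $\mathcal D$ with labels given by $h^\star$. - $A$ is a *PAC learner* if for all $\varepsilon,\delta\in(0,1)$ there is $N$ such that for all $n\ge N$, $h^\star\in\mathcal H$ and $\mathcal D$, with probability at least $1-\delta$ over $S$, $\mathbb E_{x\sim\mathcal D}[\ell(A(S)(x),h^\star(x))]\le\varepsilon$. - $A$ is a *cut-off PAC learner* if for all $\varepsilon,\delta,\gamma\in(0,1)$ there is $N$ such that for all $n\ge N$, $h^\star\in\mathcal H$ and $\mathcal D$, with probability at least $1-\delta$ over $S$, $\Pr_{x\sim\mathcal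 D}[\ell(A(S)(x),h^\star(x))>\gamma]\le\varepsilon$. (Learners need not be measurable in the sample; "with probability at least $1-\delta$" means that the exceptional set of samples has outer measure at most $\delta$.) **Theorem.** 1. The following are equivalent: every ERM for $\mathcal H$ is a cut-off PAC learner; every ERM for $\mathcal H$ is a cut-off PAC learner with $N=N(\varepsilon,\delta,\gamma)$ the same for all ERMs; $\mathbb D^{\mathrm G}_\gamma(\mathcal H)<\infty$ for all $\gamma\in(0,1)$. 2. If every ERM for $\mathcal H$ is a PAC learner, then $\mathbb D^{\mathrm G}_\gamma(\mathcal H)<\infty$ for all $\gamma\in(0,1)$. 3. If $\ell$ is bounded, the following are equivalent: every ERM for $\mathcal H$ is a PAC learner; every ERM for $\mathcal H$ is a PAC learner with $N=N(\varepsilon,\delta)$ the same for all ERMs; $\mathbb D^{\mathrm G}_\gamma(\mathcal H)<\infty$ for all $\gamma\in(0,1)$. -/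

import Mathlib

open MeasureTheory
open scoped NNReal ENNReal

/-- `ℓ` is a `c`-approximate pseudo-metric on the label set `Y`: it vanishes on the diagonal, is
symmetric and satisfies the triangle inequality up to the factor `c ≥ 1`. -/
structure IsApproxPseudoMetric {Y : Type*} (c : ℝ≥0) (ℓ : Y → Y → ℝ≥0) : Prop where
  one_le : 1 ≤ c
  self : ∀ y, ℓ y y = 0
  symm : ∀ y₁ y₂, ℓ y₁ y₂ = ℓ y₂ y₁
  triangle : ∀ y₁ y₂ y₃, ℓ y₁ y₂ ≤ c * (ℓ y₁ y₃ + ℓ y₂ y₃)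

/-- The sample `x = (x₁, …, xₙ)` is `γ`-graph shattered by `H`. -/
def GraphShatters {X Y : Type*} (ℓ : Y → Y → ℝ≥0) (H : Set (X → Y)) (γ : ℝ) {n : ℕ}
    (x : Fin n → X) : Prop :=
  ∃ f : Fin n → Y, ∀ b : Fin n → Bool, ∃ h ∈ H,
    (∀ i, b i = false → h (x i) = f i) ∧ (∀ i, b i = true → γ < (ℓ (h (x i)) (f i) : ℝ))

/-- The `γ`-graph dimension: the largest size of a `γ`-graph shattered sample, `⊤` if there are
arbitrarily large ones. -/
noncomputable def graphDim {X Y : Type*} (ℓ : Y → Y → ℝ≥0) (H : Set (X → Y)) (γ : ℝ) : ℕ∞ :=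
  ⨆ (n : ℕ) (_ : ∃ x : Fin n → X, GraphShatters ℓ H γ x), (n : ℕ∞)

/-- A learning algorithm: it turns a labelled sample of any size into a predictor. -/
abbrev Learner (X Y : Type*) := (n : ℕ) → (Fin n → X × Y) → X → Y

/-- The sample of the points `x` labelled by the target `h`. -/
def labelled {X Y : Type*} (h : X → Y) {n : ℕ} (x : Fin n → X) : Fin n → X × Y :=
  fun i => (x i, h (x i))

/-- `A` is an ERM for `H`: on every realizable sample it returns a hypothesis of the class that
fits all the labels of the sample. -/
def IsERM {X Y : Type*} (H : Set (X → Y)) (A : Learner X Y) : Prop :=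
  ∀ (n : ℕ) (S : Fin n → X × Y), (∃ h ∈ H, ∀ i, h (S i).1 = (S i).2) →
    A n S ∈ H ∧ ∀ i, A n S (S i).1 = (S i).2

/-- With `n` samples, `A` has expected loss at most `ε` with probability at least `1 - δ`, for
every target in `H` and every distribution on `X`. The (outer) probability of the set of bad
samples is bounded, as `A` need not depend measurably on the sample. -/
def PACGuarantee {X Y : Type*} [MeasurableSpace X] (ℓ : Y → Y → ℝ≥0) (H : Set (X → Y))
    (A : Learner X Y) (ε δ : ℝ) (n : ℕ) : Prop :=
  ∀ h ∈ H, ∀ D : Measure X, IsProbabilityMeasure D →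
    Measure.pi (fun _ : Fin n => D)
      {x | ¬ ∫⁻ z, (ℓ (A n (labelled h x) z) (h z) : ℝ≥0∞) ∂D ≤ ENNReal.ofReal ε}
        ≤ ENNReal.ofReal δ

/-- With `n` samples, the loss of `A` on a fresh point exceeds `γ` with probability at most `ε`,
with probability at least `1 - δ` over the sample, for every target in `H` and every distribution
on `X`. -/
def CutoffPACGuarantee {X Y : Type*} [MeasurableSpace X] (ℓ : Y → Y → ℝ≥0) (H : Set (X → Y))
    (A : Learner X Y) (ε δ γ : ℝ) (n : ℕ) : Prop :=
  ∀ h ∈ H, ∀ D : Measure X, IsProbabilityMeasure D →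
    Measure.pi (fun _ : Fin n => D)
      {x | ¬ D {z | γ < (ℓ (A n (labelled h x) z) (h z) : ℝ)} ≤ ENNReal.ofReal ε}
        ≤ ENNReal.ofReal δ

/-- `A` is a PAC learner for `H` in realizable regression with loss `ℓ`. -/
def IsPACLearner {X Y : Type*} [MeasurableSpace X] (ℓ : Y → Y → ℝ≥0) (H : Set (X → Y))
    (A : Learner X Y) : Prop :=
  ∀ ε ∈ Set.Ioo (0 : ℝ) 1, ∀ δ ∈ Set.Ioo (0 : ℝ) 1, ∃ N : ℕ, ∀ n ≥ N, PACGuarantee ℓ H A ε δ n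

/-- `A` is a cut-off PAC learner for `H` in realizable regression with loss `ℓ`. -/
def IsCutoffPACLearner {X Y : Type*} [MeasurableSpace X] (ℓ : Y → Y → ℝ≥0) (H : Set (X → Y))
    (A : Learner X Y) : Prop :=
  ∀ ε ∈ Set.Ioo (0 : ℝ) 1, ∀ δ ∈ Set.Ioo (0 : ℝ) 1, ∀ γ ∈ Set.Ioo (0 : ℝ) 1,
    ∃ N : ℕ, ∀ n ≥ N, CutoffPACGuarantee ℓ H A ε δ γ n

/-- Admissibility in the sense of empirical process theory ("image admissible Suslin"): `H` is
parametrized by a standard Borel space `T` so that, for every target in `H`, the loss against the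
target and the event of agreement with the target are jointly measurable in parameter and point.
If `Y` carries a `σ`-algebra for which `ℓ` and the diagonal are measurable (such as the Borel
`σ`-algebra of `[0,1]`), joint measurability of `(t, x) ↦ φ t x` suffices; a Suslin parameter
space, being a measurable image of a standard Borel one, gives nothing more. -/
def IsAdmissible {X Y : Type*} [MeasurableSpace X] (ℓ : Y → Y → ℝ≥0) (H : Set (X → Y)) : Prop :=
  ∃ (T : Type) (_ : MeasurableSpace T) (_ : StandardBorelSpace T) (φ : T → X → Y),
    Set.range φ = H ∧ ∀ s : T,
      Measurable (fun p : T × X => ℓ (φ p.1 p.2) (φ s p.2)) ∧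
      MeasurableSet {p : T × X | φ p.1 p.2 = φ s p.2}

/-!
*Finite graph dimension suffices.* Fix a target `g` and a cut-off `γ`. Each hypothesis `h` induces a
partial concept (`lossPattern`): `1` where `ℓ (h x) (g x) > γ`, `0` where `h x = g x`, undefined
elsewhere. A set shattered by these partial concepts is graph shattered with the labels of `g`, so
their VC dimension is at most the graph dimension `d`. An ERM outputs a hypothesis with pattern `0`
on the whole sample, and it has to be shown that all such hypotheses have a small probability of
the pattern `1`.

Sauer's lemma fails for partial classes, but on `2 n` points there is a family of
`exp (O ((d + 1) log² n))` total functions such that every partial concept is extended by one of them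
(`exists_disambiguation`). It comes from a halving argument that uses the number of shattered sets
as potential. This is small enough for the classical symmetrization: a ghost sample detects a
consistent hypothesis of large error (`measure_consistent_le_measure_ghostEvent`), and under random
swaps between the two samples each total function contributes an exponentially small
probability (`card_swap_le`, `measure_ghostEvent_le`).

The ghost event is a union over the class. By admissibility it is the projection along a standard
Borel space of a measurable set, and the averaging over swaps needs such a projection to be
approximated from inside by measurable sets. This is
`MeasurableSet.exists_subset_snd_image_measure_le_add`, which reduces to the capacitability of
analytic sets (`MeasureTheory.AnalyticSet.exists_isCompact_measure_le_add`).

*Finite graph dimension is necessary.* On the uniform distribution over a large shattered set, an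
ERM can be wrong at all points that it has not seen
(`exists_isERM_forall_not_cutoffPACGuarantee`).

The expected loss is compared with the cut-off loss by Markov's inequality in one direction
(`PACGuarantee.cutoff`) and by boundedness of the loss in the other (`CutoffPACGuarantee.pac`).
-/

/-! ### Measurable projection -/

theorem isCompact_box (k : ℕ → ℕ) : IsCompact {x : ℕ → ℕ | ∀ i, x i ≤ k i} := by
  have : {x : ℕ → ℕ | ∀ i, x i ≤ k i} = Set.univ.pi fun i => Set.Iic (k i) := by
    ext x
    simp only [Set.mem_univ_pi, Set.mem_Iic]
    rfl
  rw [this]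
  exact isCompact_univ_pi fun i => (Set.finite_Iic (k i)).isCompact

/-- An open set of sequences that contains a box `∏ i, [0, k i]` already contains the sequences
bounded by `k` in finitely many coordinates. -/
theorem exists_truncated_box_subset {V : Set (ℕ → ℕ)} (hV : IsOpen V) (k : ℕ → ℕ)
    (hK : {x : ℕ → ℕ | ∀ i, x i ≤ k i} ⊆ V) :
    ∃ n, {x : ℕ → ℕ | ∀ i < n, x i ≤ k i} ⊆ V := by
  have hloc : ∀ x ∈ {x : ℕ → ℕ | ∀ i, x i ≤ k i}, ∃ n, PiNat.cylinder x n ⊆ V := by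
    intro x hx
    obtain ⟨s, ⟨y, n, rfl⟩, hxs, hsV⟩ :=
      (PiNat.isTopologicalBasis_cylinders (fun _ : ℕ => ℕ)).exists_subset_of_mem_open (hK hx) hV
    exact ⟨n, by rwa [PiNat.mem_cylinder_iff_eq.1 hxs]⟩
  choose! N hN using hloc
  obtain ⟨t, htK, htc⟩ := (isCompact_box k).elim_nhds_subcover (fun x => PiNat.cylinder x (N x))
    fun x _ => (PiNat.isOpen_cylinder _ x (N x)).mem_nhds (PiNat.self_mem_cylinder x (N x))
  refine ⟨t.sup N, fun x hx => ?_⟩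
  -- truncating `x` by `k` moves it into the box without changing the relevant coordinates
  have hy : (fun i => min (x i) (k i)) ∈ {x : ℕ → ℕ | ∀ i, x i ≤ k i} := fun i => min_le_right _ _
  obtain ⟨z, hzt, hz⟩ := Set.mem_iUnion₂.1 (htc hy)
  refine hN z (htK z hzt) fun i hi => ?_
  rw [← hz i hi]
  exact (min_eq_left (hx i (hi.trans_le (Finset.le_sup hzt)))).symm

/-- Choquet's capacitability theorem for finite measures: the outer measure of an analytic set is
approximated from inside by compact sets. -/
theorem MeasureTheory.AnalyticSet.exists_isCompact_measure_le_add {α : Type*} [TopologicalSpace α]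
    [PolishSpace α] [MeasurableSpace α] [BorelSpace α] (μ : Measure α) [IsFiniteMeasure μ]
    {s : Set α} (hs : AnalyticSet s) {ε : ℝ≥0∞} (hε : ε ≠ 0) :
    ∃ K ⊆ s, IsCompact K ∧ μ s ≤ μ K + ε := by
  rw [AnalyticSet] at hs
  obtain rfl | ⟨f, hf, rfl⟩ := hs
  · exact ⟨∅, le_rfl, isCompact_empty, by simp⟩
  obtain ⟨e, he, hesum⟩ := ENNReal.exists_pos_sum_of_countable' hε ℕ
  have step : ∀ (B : Set (ℕ → ℕ)) (n : ℕ), ∃ k, μ (f '' B) ≤ μ (f '' (B ∩ {x | x n ≤ k})) + e n := by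
    intro B n
    have hU : f '' B = ⋃ k, f '' (B ∩ {x | x n ≤ k}) := by
      rw [← Set.image_iUnion, ← Set.inter_iUnion]
      congr 1
      refine (Set.inter_eq_left.2 fun x _ => ?_).symm
      exact Set.mem_iUnion.2 ⟨x n, le_refl (x n)⟩
    have hmono : Monotone fun k => f '' (B ∩ {x | x n ≤ k}) := fun a b hab =>
      Set.image_mono (Set.inter_subset_inter_right _ fun x (hx : x n ≤ a) => hx.trans hab)
    rcases le_or_gt (μ (f '' B)) (e n) with h | h
    · exact ⟨0, h.trans le_add_self⟩
    · have hlt : μ (f '' B) - e n < ⨆ k, μ (f '' (B ∩ {x | x n ≤ k})) := by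
        rw [← hmono.measure_iUnion, ← hU]
        exact ENNReal.sub_lt_self (measure_ne_top _ _) ((he n).trans h).ne' (he n).ne'
      obtain ⟨k, hk⟩ := lt_iSup_iff.1 hlt
      exact ⟨k, tsub_le_iff_right.1 hk.le⟩
  choose κ hκ using step
  let B : ℕ → Set (ℕ → ℕ) := fun n => Nat.rec Set.univ (fun n B => B ∩ {x | x n ≤ κ B n}) n
  have hB : ∀ n, B (n + 1) = B n ∩ {x | x n ≤ κ (B n) n} := fun n => rfl
  set k : ℕ → ℕ := fun n => κ (B n) n with hk
  have hBeq : ∀ n, B n = {x | ∀ i < n, x i ≤ k i} := by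
    intro n
    induction n with
    | zero => simp [B]
    | succ n ih =>
      ext x
      change x ∈ B n ∧ x n ≤ k n ↔ ∀ i < n + 1, x i ≤ k i
      rw [ih]
      simp only [Nat.lt_succ_iff_lt_or_eq, or_imp, forall_and, forall_eq]
      exact Iff.rfl
  have hsum : ∀ n, μ (Set.range f) ≤ μ (f '' B n) + ∑ i ∈ Finset.range n, e i := by
    intro n
    induction n with
    | zero => simp [B]
    | succ n ih =>
      rw [Finset.sum_range_succ, hB]
      calc _ ≤ _ := ih
        _ ≤ _ := add_le_add_left (hκ (B n) n) _
        _ = _ := by ring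
  refine ⟨f '' {x | ∀ i, x i ≤ k i}, Set.image_subset_range _ _, ?_, ?_⟩
  · exact (isCompact_box k).image hf
  · rw [Set.measure_eq_iInf_isOpen (f '' {x | ∀ i, x i ≤ k i}) μ, ← tsub_le_iff_right]
    refine le_iInf₂ fun U hU => le_iInf fun hUo => ?_
    rw [tsub_le_iff_right]
    obtain ⟨n, hn⟩ := exists_truncated_box_subset (hUo.preimage hf) k (Set.image_subset_iff.1 hU)
    refine (hsum n).trans (add_le_add ?_ ((ENNReal.sum_le_tsum _).trans hesum.le))
    rw [hBeq]
    exact measure_mono (Set.image_subset_iff.2 hn)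

/-- A measurable subset of `T × Ω` depends on its second coordinate only through a measurable map
to a standard Borel space, as it lies in the `σ`-algebra generated by countably many rectangles. -/
theorem MeasurableSet.exists_standardBorel_factor {T Ω : Type*} [MeasurableSpace T]
    [MeasurableSpace Ω] {W : Set (T × Ω)} (hW : MeasurableSet W) :
    ∃ (C : Type) (_ : MeasurableSpace C) (_ : StandardBorelSpace C) (g : Ω → C) (W' : Set (T × C)),
      Measurable g ∧ MeasurableSet W' ∧ W = {p | (p.1, g p.2) ∈ W'} := by
  classical
  refine MeasurableSpace.induction_on_inter (C := fun W _ =>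
    ∃ (C : Type) (_ : MeasurableSpace C) (_ : StandardBorelSpace C) (g : Ω → C) (W' : Set (T × C)),
      Measurable g ∧ MeasurableSet W' ∧ W = {p | (p.1, g p.2) ∈ W'})
    generateFrom_prod.symm isPiSystem_prod ?_ ?_ ?_ ?_ W hW
  · exact ⟨Unit, inferInstance, inferInstance, fun _ => (), ∅, measurable_const, .empty, by simp⟩
  · rintro _ ⟨A, hA, B, hB, rfl⟩
    refine ⟨Bool, inferInstance, inferInstance, fun ω => decide (ω ∈ B), A ×ˢ {true}, ?_,
      hA.prod (measurableSet_singleton _), by ext; simp⟩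
    refine measurable_to_bool ?_
    convert! hB
    ext; simp
  · rintro W _ ⟨C, _, _, g, W', hg, hW', rfl⟩
    exact ⟨C, inferInstance, inferInstance, g, W'ᶜ, hg, hW'.compl, rfl⟩
  · intro f _ _ ih
    choose C i1 i2 g W' hg hW' hf using ih
    refine ⟨∀ n, C n, inferInstance, inferInstance, fun ω n => g n ω,
      ⋃ n, {p | (p.1, p.2 n) ∈ W' n}, measurable_pi_lambda _ hg, ?_, ?_⟩
    · refine .iUnion fun n => ?_
      exact (measurable_fst.prodMk ((measurable_pi_apply n).comp measurable_snd)) (hW' n)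
    · ext p
      simp [hf]

/-- Measurable projection: the projection of a measurable set along a standard Borel space is
approximated from inside by measurable sets, for every finite measure. -/
theorem MeasurableSet.exists_subset_snd_image_measure_le_add {T Ω : Type*} [MeasurableSpace T]
    [StandardBorelSpace T] [MeasurableSpace Ω] (μ : Measure Ω) [IsFiniteMeasure μ]
    {W : Set (T × Ω)} (hW : MeasurableSet W) {ε : ℝ≥0∞} (hε : ε ≠ 0) :
    ∃ Z ⊆ {ω | ∃ t, (t, ω) ∈ W}, MeasurableSet Z ∧ μ {ω | ∃ t, (t, ω) ∈ W} ≤ μ Z + ε := by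
  obtain ⟨C, _, _, g, W', hg, hW', rfl⟩ := hW.exists_standardBorel_factor
  let _ := upgradeStandardBorel C
  have hZ : AnalyticSet (Prod.snd '' W') := hW'.analyticSet_image measurable_snd
  obtain ⟨K, hKs, hK, hle⟩ := hZ.exists_isCompact_measure_le_add (μ.map g) hε
  have heq : {ω | ∃ t, (t, ω) ∈ {p : T × Ω | (p.1, g p.2) ∈ W'}} = g ⁻¹' (Prod.snd '' W') := by
    ext ω; simp
  refine ⟨g ⁻¹' K, ?_, hg hK.measurableSet, ?_⟩
  · rw [heq]
    exact Set.preimage_mono hKs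
  · rw [heq, ← Measure.map_apply hg hK.measurableSet]
    exact (Measure.le_map_apply hg.aemeasurable _).trans hle

/-! ### Partial concept classes -/

section PartialClass

variable {ι : Type*}

/-- The set `S` is shattered by the class `V` of partial `{0, 1}`-valued functions (with value
`none` where undefined): every total pattern on `S` is the restriction of a member of `V`. -/
def PartialShatters (V : Set (ι → Option Bool)) (S : Finset ι) : Prop :=
  ∀ b : ι → Bool, ∃ v ∈ V, ∀ i ∈ S, v i = some (b i)

theorem PartialShatters.mono {V W : Set (ι → Option Bool)} (h : V ⊆ W) {S : Finset ι}
    (hS : PartialShatters V S) : PartialShatters W S := fun b =>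
  let ⟨v, hv, hb⟩ := hS b
  ⟨v, h hv, hb⟩

theorem partialShatters_empty {V : Set (ι → Option Bool)} (hV : V.Nonempty) :
    PartialShatters V ∅ := fun _ =>
  let ⟨v, hv⟩ := hV
  ⟨v, hv, by simp⟩

theorem PartialShatters.not_mem_of_const {V : Set (ι → Option Bool)} {x : ι} {y : Bool}
    {S : Finset ι} (hS : PartialShatters {v ∈ V | v x = some y} S) : x ∉ S := by
  intro hx
  obtain ⟨v, ⟨-, hv⟩, hb⟩ := hS fun _ => !y
  have := hb x hx
  rw [hv] at this
  simp at this

variable [Fintype ι]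

open Classical in
/-- The finite family of sets shattered by the partial class `V`. -/
noncomputable def partialShatterer (V : Set (ι → Option Bool)) : Finset (Finset ι) :=
  Finset.univ.filter (PartialShatters V)

@[simp] theorem mem_partialShatterer {V : Set (ι → Option Bool)} {S : Finset ι} :
    S ∈ partialShatterer V ↔ PartialShatters V S := by
  simp [partialShatterer]

variable [DecidableEq ι]

/-- Fixing the value at `x` in the two possible ways splits a partial class into two subclasses
that together shatter at most as many sets: a set `S` shattered by both is accounted for by `S` and
`insert x S`. -/
theorem card_partialShatterer_add_le (V : Set (ι → Option Bool)) (x : ι) :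
    (partialShatterer {v ∈ V | v x = some false}).card +
      (partialShatterer {v ∈ V | v x = some true}).card ≤ (partialShatterer V).card := by
  set A := partialShatterer {v ∈ V | v x = some false}
  set B := partialShatterer {v ∈ V | v x = some true}
  have hxA : ∀ S ∈ A, x ∉ S := fun S hS => (mem_partialShatterer.1 hS).not_mem_of_const
  have hxB : ∀ S ∈ B, x ∉ S := fun S hS => (mem_partialShatterer.1 hS).not_mem_of_const
  have hinj : Set.InjOn (insert x) ((A ∩ B : Finset (Finset ι)) : Set (Finset ι)) := by
    intro S hS S' hS' h
    rw [Finset.mem_coe, Finset.mem_inter] at hS hS'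
    rw [← Finset.erase_insert (hxA S hS.1), ← Finset.erase_insert (hxA S' hS'.1)]
    exact congrArg (fun Q => Finset.erase Q x) h
  have hdisj : Disjoint (A ∪ B) ((A ∩ B).image (insert x)) := by
    rw [Finset.disjoint_left]
    intro S hS hS'
    obtain ⟨S', -, rfl⟩ := Finset.mem_image.1 hS'
    rcases Finset.mem_union.1 hS with h | h
    · exact hxA _ h (Finset.mem_insert_self _ _)
    · exact hxB _ h (Finset.mem_insert_self _ _)
  have hsub : (A ∪ B) ∪ (A ∩ B).image (insert x) ⊆ partialShatterer V := by
    intro S hS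
    rw [mem_partialShatterer]
    rcases Finset.mem_union.1 hS with h | h
    · rcases Finset.mem_union.1 h with h | h
      · exact (mem_partialShatterer.1 h).mono fun v hv => hv.1
      · exact (mem_partialShatterer.1 h).mono fun v hv => hv.1
    · obtain ⟨S', hS', rfl⟩ := Finset.mem_image.1 h
      obtain ⟨hA, hB⟩ := Finset.mem_inter.1 hS'
      intro b
      have key : ∃ v ∈ {v ∈ V | v x = some (b x)}, ∀ i ∈ S', v i = some (b i) := by
        cases b x
        · exact mem_partialShatterer.1 hA b
        · exact mem_partialShatterer.1 hB b
      obtain ⟨v, ⟨hv, hvx⟩, hb⟩ := key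
      refine ⟨v, hv, fun i hi => ?_⟩
      rcases Finset.mem_insert.1 hi with rfl | hi
      · exact hvx
      · exact hb i hi
  calc A.card + B.card = (A ∪ B).card + ((A ∩ B).image (insert x)).card := by
        rw [Finset.card_image_of_injOn hinj, Finset.card_union_add_card_inter]
    _ = ((A ∪ B) ∪ (A ∩ B).image (insert x)).card := (Finset.card_union_of_disjoint hdisj).symm
    _ ≤ _ := Finset.card_le_card hsub

theorem card_partialShatterer_le {V : Set (ι → Option Bool)} {d : ℕ}
    (hd : ∀ S, PartialShatters V S → S.card ≤ d) :
    (partialShatterer V).card ≤ (Fintype.card ι + 1) ^ d := by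
  -- a set of at most `d` elements is the set of values of a map `Fin d → Option ι`
  have hsub : partialShatterer V ⊆ (Finset.univ : Finset (Fin d → Option ι)).image
      fun u => Finset.univ.filter fun i => ∃ j, u j = some i := by
    intro S hS
    have hS' := hd S (mem_partialShatterer.1 hS)
    refine Finset.mem_image.2 ⟨fun j => if h : j.1 < S.card then some (S.equivFin.symm ⟨j.1, h⟩)
      else none, Finset.mem_univ _, ?_⟩
    ext i
    simp only [Finset.mem_filter, Finset.mem_univ, true_and]
    constructor
    · rintro ⟨j, hj⟩
      split_ifs at hj with h
      rw [← Option.some.inj hj]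
      exact Subtype.property _
    · intro hi
      exact ⟨⟨S.equivFin ⟨i, hi⟩, (S.equivFin ⟨i, hi⟩).2.trans_le hS'⟩, by simp⟩
  calc _ ≤ _ := Finset.card_le_card hsub
    _ ≤ _ := Finset.card_image_le
    _ = _ := by simp

/-- Disambiguation by a halving argument. Going through the points of `P` one at a time, predict
at each the value whose subclass shatters more sets. A member of the class that contradicts a
prediction lies in a subclass that shatters at most half as many sets, so this happens fewer than
`L` times; the list of these mistakes determines a total function that extends it on `P`. -/
theorem exists_disambiguation_on (P : Finset ι) (L : ℕ) (V : Set (ι → Option Bool))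
    (hV : (partialShatterer V).card < 2 ^ L) :
    ∃ F : Finset (ι → Bool), F.card ≤ (P.card + 1) ^ L ∧
      ∀ v ∈ V, ∃ f ∈ F, ∀ i ∈ P, ∀ y, v i = some y → f i = y := by
  induction P using Finset.induction_on generalizing L V with
  | empty => exact ⟨{fun _ => false}, by simp, fun v _ => ⟨fun _ => false, by simp, by simp⟩⟩
  | insert x P hx ih =>
    cases L with
    | zero =>
      have hVe : V = ∅ := by
        by_contra h
        have : ∅ ∈ partialShatterer V :=
          mem_partialShatterer.2 (partialShatters_empty (Set.nonempty_iff_ne_empty.2 h))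
        have := Finset.card_pos.2 ⟨_, this⟩
        omega
      exact ⟨∅, by simp, by simp [hVe]⟩
    | succ L =>
      have hy : ∃ y, (partialShatterer {v ∈ V | v x = some y}).card < 2 ^ L := by
        have h := card_partialShatterer_add_le V x
        by_contra! hc
        have h1 := hc false
        have h2 := hc true
        rw [pow_succ] at hV
        omega
      obtain ⟨y, hy⟩ := hy
      obtain ⟨F₁, hF₁, h₁⟩ := ih (L + 1) V hV
      obtain ⟨F₂, hF₂, h₂⟩ := ih L _ hy
      refine ⟨F₁.image (fun f => Function.update f x (!y)) ∪
        F₂.image (fun f => Function.update f x y), ?_, fun v hv => ?_⟩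
      · refine (Finset.card_union_le _ _).trans ?_
        refine (add_le_add (Finset.card_image_le.trans hF₁) (Finset.card_image_le.trans hF₂)).trans ?_
        rw [Finset.card_insert_of_notMem hx]
        calc (P.card + 1) ^ (L + 1) + (P.card + 1) ^ L = (P.card + 1) ^ L * (P.card + 1 + 1) := by
              ring
          _ ≤ (P.card + 1 + 1) ^ L * (P.card + 1 + 1) := by gcongr; omega
          _ = _ := (pow_succ _ _).symm
      · have ext_update : ∀ (f : ι → Bool) (z : Bool), (∀ w, v x = some w → z = w) →
            (∀ i ∈ P, ∀ w, v i = some w → f i = w) →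
            ∀ i ∈ insert x P, ∀ w, v i = some w → Function.update f x z i = w := by
          intro f z hz hf i hi w hw
          rcases eq_or_ne i x with rfl | hne
          · rw [Function.update_self]
            exact hz w hw
          · rw [Function.update_of_ne hne]
            exact hf i (Finset.mem_of_mem_insert_of_ne hi hne) w hw
        by_cases hvx : v x = some y
        · obtain ⟨f, hf, hfv⟩ := h₂ v ⟨hv, hvx⟩
          exact ⟨_, Finset.mem_union_right _ (Finset.mem_image_of_mem _ hf),
            ext_update f y (fun w hw => by simpa [hvx] using hw) hfv⟩
        · obtain ⟨f, hf, hfv⟩ := h₁ v hv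
          refine ⟨_, Finset.mem_union_left _ (Finset.mem_image_of_mem _ hf),
            ext_update f (!y) (fun w hw => ?_) hfv⟩
          have : w ≠ y := fun h => hvx (h ▸ hw)
          revert this
          cases w <;> cases y <;> simp

theorem exists_disambiguation {V : Set (ι → Option Bool)} {d L : ℕ}
    (hd : ∀ S, PartialShatters V S → S.card ≤ d) (hL : (Fintype.card ι + 1) ^ d < 2 ^ L) :
    ∃ F : Finset (ι → Bool), F.card ≤ (Fintype.card ι + 1) ^ L ∧
      ∀ v ∈ V, ∃ f ∈ F, ∀ i y, v i = some y → f i = y := by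
  obtain ⟨F, hF, h⟩ := exists_disambiguation_on Finset.univ L V
    ((card_partialShatterer_le hd).trans_lt hL)
  exact ⟨F, by simpa using hF, fun v hv => by simpa using h v hv⟩

end PartialClass

/-! ### Random swaps -/

/-- For a fixed labelling `f` of a double sample, few of the ways `σ` to split the pairs into
a training and a test sample put no label `true` into the first and at least `k` into the second,
as `σ` is forced at every pair that contributes to the count. -/
theorem card_swap_le {n : ℕ} (f : Fin n × Bool → Bool) (k : ℕ) :
    (Finset.univ.filter fun σ : Fin n → Bool => (∀ i, f (i, σ i) = false) ∧
      k ≤ (Finset.univ.filter fun i => f (i, !σ i) = true).card).card * 2 ^ k ≤ 2 ^ n := by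
  set G := Finset.univ.filter fun σ : Fin n → Bool => (∀ i, f (i, σ i) = false) ∧
      k ≤ (Finset.univ.filter fun i => f (i, !σ i) = true).card with hG
  rcases G.eq_empty_or_nonempty with h | ⟨σ, hσ⟩
  · simp [h]
  obtain ⟨h0, hk⟩ := (Finset.mem_filter.1 hσ).2
  set J := Finset.univ.filter fun i => f (i, !σ i) = true with hJ
  have hsub : G ⊆ Fintype.piFinset fun i => if i ∈ J then {σ i} else Finset.univ := by
    intro τ hτ
    obtain ⟨hτ0, -⟩ := (Finset.mem_filter.1 hτ).2
    refine Fintype.mem_piFinset.2 fun i => ?_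
    split_ifs with hi
    · rw [Finset.mem_singleton]
      by_contra hne
      have h1 : f (i, !σ i) = true := (Finset.mem_filter.1 hi).2
      have h2 := hτ0 i
      rw [Bool.eq_not.2 hne, h1] at h2
      exact Bool.noConfusion h2
    · exact Finset.mem_univ _
  have hcard : (Fintype.piFinset fun i => if i ∈ J then {σ i} else (Finset.univ : Finset Bool)).card
      = 2 ^ (n - J.card) := by
    rw [Fintype.card_piFinset]
    have : ∀ i, (if i ∈ J then {σ i} else (Finset.univ : Finset Bool)).card
        = if i ∈ J then 1 else 2 := by
      intro i; split_ifs <;> simp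
    simp only [this]
    rw [Finset.prod_ite]
    simp only [Finset.prod_const_one, one_mul, Finset.prod_const]
    congr 1
    rw [← Finset.compl_filter, Finset.card_compl]
    simp
  have hJn : J.card ≤ n := by simpa using Finset.card_le_univ J
  calc G.card * 2 ^ k ≤ 2 ^ (n - J.card) * 2 ^ J.card := by
        refine Nat.mul_le_mul (hcard ▸ Finset.card_le_card hsub) (Nat.pow_le_pow_right two_pos hk)
    _ = 2 ^ n := by rw [← pow_add, Nat.sub_add_cancel hJn]

/-! ### Symmetrization -/

section Symmetrization

variable {T X : Type*}

/-- The double samples for which some parameter has the value `some false` on all first points and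
the value `some true` on at least `k` of the second points. -/
def ghostEvent (p : T → X → Option Bool) (n k : ℕ) : Set (Fin n → X × X) :=
  {ω | ∃ t, (∀ i, p t (ω i).1 = some false) ∧
    k ≤ (Finset.univ.filter fun i => p t (ω i).2 = some true).card}

/-- Exchange the two points of the pairs selected by `σ`. -/
def swapPairs {n : ℕ} (σ : Fin n → Bool) (ω : Fin n → X × X) : Fin n → X × X :=
  fun i => if σ i then (ω i).swap else ω i

/-- The double sample as a family of points; `(i, false)` is the first point of the pair `i`. -/
def pairPoint {n : ℕ} (ω : Fin n → X × X) (q : Fin n × Bool) : X :=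
  if q.2 then (ω q.1).2 else (ω q.1).1

/-- On a fixed double sample, the class may be replaced by the family of total functions that
disambiguates it, and `card_swap_le` applies to each of these. -/
theorem card_swapPairs_mem_ghostEvent_le (p : T → X → Option Bool) {n d L : ℕ} (k : ℕ)
    (hL : (2 * n + 1) ^ d < 2 ^ L) (ω : Fin n → X × X)
    (hd : ∀ S : Finset (Fin n × Bool),
      PartialShatters (Set.range fun t q => p t (pairPoint ω q)) S → S.card ≤ d)
    [DecidablePred fun σ => swapPairs σ ω ∈ ghostEvent p n k] :
    (Finset.univ.filter fun σ => swapPairs σ ω ∈ ghostEvent p n k).card * 2 ^ k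
      ≤ (2 * n + 1) ^ L * 2 ^ n := by
  have hcard : Fintype.card (Fin n × Bool) = 2 * n := by simp [mul_comm]
  obtain ⟨F, hF, hdis⟩ := exists_disambiguation (L := L) hd (by rwa [hcard])
  rw [hcard] at hF
  have hsub : (Finset.univ.filter fun σ => swapPairs σ ω ∈ ghostEvent p n k) ⊆
      F.biUnion fun f => Finset.univ.filter fun σ : Fin n → Bool => (∀ i, f (i, σ i) = false) ∧
        k ≤ (Finset.univ.filter fun i => f (i, !σ i) = true).card := by
    intro σ hσ
    obtain ⟨t, h0, hk⟩ := (Finset.mem_filter.1 hσ).2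
    obtain ⟨f, hf, hfv⟩ := hdis _ ⟨t, rfl⟩
    have h1 : ∀ i, (swapPairs σ ω i).1 = pairPoint ω (i, σ i) := by
      intro i; unfold swapPairs pairPoint; cases σ i <;> simp
    have h2 : ∀ i, (swapPairs σ ω i).2 = pairPoint ω (i, !σ i) := by
      intro i; unfold swapPairs pairPoint; cases σ i <;> simp
    refine Finset.mem_biUnion.2 ⟨f, hf, Finset.mem_filter.2 ⟨Finset.mem_univ _, fun i => ?_,
      hk.trans (Finset.card_le_card fun i hi => ?_)⟩⟩
    · exact hfv _ _ ((congrArg (fun z => p t z) (h1 i)).symm.trans (h0 i))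
    · refine Finset.mem_filter.2 ⟨Finset.mem_univ _, hfv _ _ ?_⟩
      exact (congrArg (fun z => p t z) (h2 i)).symm.trans (Finset.mem_filter.1 hi).2
  calc _ ≤ (∑ f ∈ F, (Finset.univ.filter fun σ : Fin n → Bool => (∀ i, f (i, σ i) = false) ∧
        k ≤ (Finset.univ.filter fun i => f (i, !σ i) = true).card).card) * 2 ^ k :=
        Nat.mul_le_mul_right _ ((Finset.card_le_card hsub).trans Finset.card_biUnion_le)
    _ ≤ ∑ f ∈ F, 2 ^ n := by
        rw [Finset.sum_mul]
        exact Finset.sum_le_sum fun f _ => card_swap_le f k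
    _ ≤ _ := by
        rw [Finset.sum_const, smul_eq_mul]
        exact Nat.mul_le_mul_right _ hF

variable [MeasurableSpace X]

theorem measurePreserving_swapPairs {n : ℕ} (D : Measure X) [IsProbabilityMeasure D]
    (σ : Fin n → Bool) :
    MeasurePreserving (swapPairs σ) (Measure.pi fun _ => D.prod D) (Measure.pi fun _ => D.prod D) := by
  refine measurePreserving_pi _ _ (f := fun i (q : X × X) => if σ i then q.swap else q) fun i => ?_
  cases σ i
  · exact MeasurePreserving.id _
  · simpa using Measure.measurePreserving_swap

/-- The law of the double sample is invariant under swaps, so the probability of the ghost event is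
at most the largest proportion of swaps that lead into it. As the event is a projection, it need
not be measurable; averaging is justified for measurable subsets that almost exhaust it. -/
theorem measure_ghostEvent_le [MeasurableSpace T] [StandardBorelSpace T] (D : Measure X)
    [IsProbabilityMeasure D] (p : T → X → Option Bool)
    (hp : ∀ y, MeasurableSet {q : T × X | p q.1 q.2 = some y}) {n d L : ℕ} (k : ℕ)
    (hL : (2 * n + 1) ^ d < 2 ^ L)
    (hd : ∀ (ω : Fin n → X × X) (S : Finset (Fin n × Bool)),
      PartialShatters (Set.range fun t q => p t (pairPoint ω q)) S → S.card ≤ d) :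
    (Measure.pi fun _ => D.prod D) (ghostEvent p n k) ≤ ((2 * n + 1 : ℕ) : ℝ≥0∞) ^ L / 2 ^ k := by
  classical
  set μ : Measure (Fin n → X × X) := Measure.pi fun _ => D.prod D with hμ
  have hW : MeasurableSet {q : T × (Fin n → X × X) | (∀ i, p q.1 (q.2 i).1 = some false) ∧
      k ≤ (Finset.univ.filter fun i => p q.1 (q.2 i).2 = some true).card} := by
    have m1 : ∀ i, MeasurableSet {q : T × (Fin n → X × X) | p q.1 (q.2 i).1 = some false} :=
      fun i => (show Measurable fun q : T × (Fin n → X × X) => (q.1, (q.2 i).1) by fun_prop)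
        (hp false)
    have m2 : ∀ i, MeasurableSet {q : T × (Fin n → X × X) | p q.1 (q.2 i).2 = some true} :=
      fun i => (show Measurable fun q : T × (Fin n → X × X) => (q.1, (q.2 i).2) by fun_prop)
        (hp true)
    refine MeasurableSet.inter ?_ ?_
    · exact measurableSet_setOfPred.2 (Measurable.forall fun i => measurableSet_setOfPred.1 (m1 i))
    · have : Measurable fun q : T × (Fin n → X × X) =>
          ∑ i, if p q.1 (q.2 i).2 = some true then 1 else 0 :=
        Finset.measurable_sum _ fun i _ => Measurable.ite (m2 i) measurable_const measurable_const
      simp only [Finset.card_filter]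
      exact measurableSet_le measurable_const this
  refine ENNReal.le_of_forall_pos_le_add fun ε hε _ => ?_
  obtain ⟨Z, hZs, hZ, hle⟩ := hW.exists_subset_snd_image_measure_le_add μ
    (ENNReal.coe_ne_zero.2 hε.ne')
  refine hle.trans (add_le_add_left ?_ _)
  have hsum : (2 : ℝ≥0∞) ^ n * μ Z = ∫⁻ ω, ∑ σ, (swapPairs σ ⁻¹' Z).indicator 1 ω ∂μ := by
    rw [lintegral_finsetSum _ fun σ _ => measurable_one.indicator
      ((measurePreserving_swapPairs D σ).measurable hZ)]
    have : ∀ σ : Fin n → Bool, ∫⁻ ω, (swapPairs σ ⁻¹' Z).indicator 1 ω ∂μ = μ Z := fun σ => by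
      rw [lintegral_indicator_one ((measurePreserving_swapPairs D σ).measurable hZ),
        (measurePreserving_swapPairs D σ).measure_preimage hZ.nullMeasurableSet]
    simp [this]
  have hpt : ∀ ω, (∑ σ, (swapPairs σ ⁻¹' Z).indicator (1 : (Fin n → X × X) → ℝ≥0∞) ω) * 2 ^ k
      ≤ ((2 * n + 1 : ℕ) : ℝ≥0∞) ^ L * 2 ^ n := by
    intro ω
    have h := card_swapPairs_mem_ghostEvent_le p k hL ω (hd ω)
    have h' : (∑ σ, (swapPairs σ ⁻¹' Z).indicator (1 : (Fin n → X × X) → ℝ≥0∞) ω) ≤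
        ((Finset.univ.filter fun σ => swapPairs σ ω ∈ ghostEvent p n k).card : ℝ≥0∞) := by
      rw [Finset.card_filter, Nat.cast_sum]
      refine Finset.sum_le_sum fun σ _ => ?_
      by_cases hσ : swapPairs σ ω ∈ Z
      · have hg : swapPairs σ ω ∈ ghostEvent p n k := hZs hσ
        rw [if_pos hg]
        simp [Set.indicator, hσ]
      · simp [Set.indicator, hσ]
    refine (mul_le_mul_left h' _).trans ?_
    exact_mod_cast h
  rw [ENNReal.le_div_iff_mul_le (by simp) (by simp)]
  have h2 : (2 : ℝ≥0∞) ^ n ≠ 0 := by simp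
  have h2' : (2 : ℝ≥0∞) ^ n ≠ ⊤ := by simp
  rw [← ENNReal.mul_le_mul_iff_right h2 h2', ← mul_assoc, hsum, mul_comm ((2 : ℝ≥0∞) ^ n),
    ← lintegral_mul_const' _ _ (by simp)]
  calc _ ≤ ∫⁻ _, ((2 * n + 1 : ℕ) : ℝ≥0∞) ^ L * 2 ^ n ∂μ := lintegral_mono hpt
    _ = _ := by simp [hμ]

/-- By linearity of expectation, at least half of `n * ε` points of a sample of size `n` hit a set
of probability at least `ε`, with probability at least `ε / 2`. -/
theorem ofReal_half_le_measure_card_filter (D : Measure X) [IsProbabilityMeasure D] {B : Set X}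
    (hB : MeasurableSet B) {ε : ℝ} (hε : 0 ≤ ε) (hD : ENNReal.ofReal ε ≤ D B) {n k : ℕ} (hn : 0 < n)
    (hk : (k : ℝ) ≤ n * (ε / 2)) [DecidablePred (· ∈ B)] :
    ENNReal.ofReal (ε / 2) ≤
      (Measure.pi fun _ : Fin n => D) {y | k ≤ (Finset.univ.filter fun i => y i ∈ B).card} := by
  set P : Measure (Fin n → X) := Measure.pi fun _ => D with hP
  set E : Set (Fin n → X) := {y | k ≤ (Finset.univ.filter fun i => y i ∈ B).card} with hE
  have hmB : ∀ i, MeasurableSet {y : Fin n → X | y i ∈ B} := fun i => measurable_pi_apply i hB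
  have hEm : MeasurableSet E := by
    simp only [hE, Finset.card_filter]
    exact measurableSet_le measurable_const (Finset.measurable_sum _ fun i _ =>
      Measurable.ite (hmB i) measurable_const measurable_const)
  have hmean : (n : ℝ≥0∞) * D B = ∫⁻ y, ∑ i, {y : Fin n → X | y i ∈ B}.indicator 1 y ∂P := by
    rw [lintegral_finsetSum _ fun i _ => measurable_one.indicator (hmB i)]
    have : ∀ i, ∫⁻ y, {y : Fin n → X | y i ∈ B}.indicator 1 y ∂P = D B := fun i => by
      rw [lintegral_indicator_one (hmB i)]
      exact (measurePreserving_eval (fun _ : Fin n => D) i).measure_preimage hB.nullMeasurableSet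
    simp [this]
  have hle : (n : ℝ≥0∞) * D B ≤ k + n * P E := by
    rw [hmean]
    calc _ ≤ ∫⁻ y, ((k : ℝ≥0∞) + n * E.indicator 1 y) ∂P := lintegral_mono fun y => ?_
      _ = _ := by
        rw [lintegral_add_left measurable_const,
          lintegral_const_mul _ (measurable_one.indicator hEm), lintegral_indicator_one hEm]
        simp [hP]
    have hs : ∑ i, {y : Fin n → X | y i ∈ B}.indicator (1 : (Fin n → X) → ℝ≥0∞) y =
        ((Finset.univ.filter fun i => y i ∈ B).card : ℝ≥0∞) := by
      rw [Finset.card_filter, Nat.cast_sum]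
      refine Finset.sum_congr rfl fun i _ => ?_
      by_cases h : y i ∈ B <;> simp [Set.indicator, h]
    rw [hs]
    by_cases hy : y ∈ E
    · have : (Finset.univ.filter fun i => y i ∈ B).card ≤ n := by
        simpa using Finset.card_le_univ (Finset.univ.filter fun i => y i ∈ B)
      simp only [Set.indicator_of_mem hy, Pi.one_apply, mul_one]
      exact le_add_left (by exact_mod_cast this)
    · have : (Finset.univ.filter fun i => y i ∈ B).card ≤ k := (not_le.1 hy).le
      exact le_add_right (by exact_mod_cast this)
  have hn0 : (n : ℝ≥0∞) ≠ 0 := by exact_mod_cast hn.ne'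
  have hhalf : (n : ℝ≥0∞) * ENNReal.ofReal (ε / 2) + n * ENNReal.ofReal (ε / 2) ≤
      n * ENNReal.ofReal (ε / 2) + n * P E := by
    calc _ = (n : ℝ≥0∞) * ENNReal.ofReal ε := by
          rw [← mul_add, ← ENNReal.ofReal_add (by positivity) (by positivity), add_halves]
      _ ≤ n * D B := by gcongr
      _ ≤ _ := hle
      _ ≤ _ := by
        gcongr
        rw [← ENNReal.ofReal_natCast n, ← ENNReal.ofReal_mul (by positivity),
          ← ENNReal.ofReal_natCast k]
        exact ENNReal.ofReal_le_ofReal hk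
  have hfin : (n : ℝ≥0∞) * ENNReal.ofReal (ε / 2) ≠ ⊤ :=
    ENNReal.mul_ne_top (ENNReal.natCast_ne_top n) ENNReal.ofReal_ne_top
  exact (ENNReal.mul_le_mul_iff_right hn0 (ENNReal.natCast_ne_top n)).1
    ((ENNReal.add_le_add_iff_left hfin).1 hhalf)

/-- The ghost sample step. If a parameter is consistent with the sample but has a large error, then
an independent second sample detects the error with probability at least `ε / 2`. -/
theorem measure_consistent_le_measure_ghostEvent (D : Measure X) [IsProbabilityMeasure D]
    (p : T → X → Option Bool) (hp : ∀ t, MeasurableSet {x : X | p t x = some true}) {ε : ℝ}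
    (hε : 0 ≤ ε) {n k : ℕ} (hn : 0 < n) (hk : (k : ℝ) ≤ n * (ε / 2)) :
    ENNReal.ofReal (ε / 2) * (Measure.pi fun _ : Fin n => D)
      {x | ∃ t, (∀ i, p t (x i) = some false) ∧ ENNReal.ofReal ε ≤ D {z | p t z = some true}} ≤
    (Measure.pi fun _ : Fin n => D.prod D) (ghostEvent p n k) := by
  classical
  set P : Measure (Fin n → X) := Measure.pi fun _ => D with hP
  let e := MeasurableEquiv.arrowProdEquivProdArrow X X (Fin n)
  have he : MeasurePreserving e.symm (P.prod P) (Measure.pi fun _ : Fin n => D.prod D) :=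
    (measurePreserving_arrowProdEquivProdArrow X X (Fin n) (fun _ => D) (fun _ => D)).symm
  rw [← he.measure_preimage_equiv, ← measure_toMeasurable (μ := P.prod P)]
  set M := toMeasurable (P.prod P) (e.symm ⁻¹' ghostEvent p n k) with hM
  have hMm : MeasurableSet M := measurableSet_toMeasurable _ _
  rw [Measure.prod_apply hMm]
  refine le_trans ?_ (mul_meas_ge_le_lintegral (measurable_measure_prodMk_left hMm)
    (ENNReal.ofReal (ε / 2)))
  refine mul_le_mul_right (measure_mono ?_) _
  rintro x ⟨t, hx, ht⟩
  refine (ofReal_half_le_measure_card_filter D (hp t) hε ht hn hk).trans (measure_mono ?_)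
  intro y hy
  exact subset_toMeasurable _ _ ⟨t, hx, hy⟩

/-- Uniform bound on the probability that some parameter is consistent with the sample although its
error is at least `ε`, for a partial concept class of VC dimension at most `d` on `2 * n` points. -/
theorem measure_consistent_le [MeasurableSpace T] [StandardBorelSpace T] (D : Measure X)
    [IsProbabilityMeasure D] (p : T → X → Option Bool)
    (hp : ∀ y, MeasurableSet {q : T × X | p q.1 q.2 = some y}) {n d L k : ℕ}
    (hL : (2 * n + 1) ^ d < 2 ^ L)
    (hd : ∀ (ω : Fin n → X × X) (S : Finset (Fin n × Bool)),
      PartialShatters (Set.range fun t q => p t (pairPoint ω q)) S → S.card ≤ d)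
    {ε : ℝ} (hε : 0 < ε) (hn : 0 < n) (hk : (k : ℝ) ≤ n * (ε / 2)) :
    (Measure.pi fun _ : Fin n => D)
      {x | ∃ t, (∀ i, p t (x i) = some false) ∧ ENNReal.ofReal ε ≤ D {z | p t z = some true}} ≤
    ENNReal.ofReal ((2 * n + 1) ^ L / 2 ^ k / (ε / 2)) := by
  have hs : ∀ t, MeasurableSet {x : X | p t x = some true} :=
    fun t => measurable_prodMk_left (hp true)
  have h := (measure_consistent_le_measure_ghostEvent D p hs hε.le hn hk).trans
    (measure_ghostEvent_le D p hp k hL hd)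
  rw [ENNReal.ofReal_div_of_pos (by positivity), ENNReal.le_div_iff_mul_le (by simp [hε]) (by simp),
    mul_comm]
  refine h.trans_eq ?_
  rw [ENNReal.ofReal_div_of_pos (by positivity), ENNReal.ofReal_pow (by positivity),
    ENNReal.ofReal_pow (by positivity)]
  congr 2
  · rw [← ENNReal.ofReal_natCast]; push_cast; rfl
  · simp

end Symmetrization

/-! ### Sample size -/

/-- The disambiguating families have size `exp (O (log² n))`, which is beaten by the exponentially
small probability of a bad swap: the base-two logarithm of the bound is
`O ((d + 1) log² n) - n ε / 2`. -/
theorem exists_sampleSize (d : ℕ) {ε δ : ℝ} (hε : 0 < ε) (hδ : 0 < δ) :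
    ∃ N : ℕ, ∀ n ≥ N, 0 < n ∧ ∃ L k : ℕ, (2 * n + 1) ^ d < 2 ^ L ∧ (k : ℝ) ≤ n * (ε / 2) ∧
      (2 * n + 1 : ℝ) ^ L / 2 ^ k / (ε / 2) ≤ δ := by
  obtain ⟨J, hJ⟩ := exists_pow_lt_of_lt_one (show 0 < δ * (ε / 2) by positivity)
    (show (1 / 2 : ℝ) < 1 by norm_num)
  -- `log² x ≤ ε x / (192 (d + 1))` at `x = 2 n + 1 ≤ 3 n` makes the exponent `(d + 1) (4 log x)²`
  -- at most `n ε / 4`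
  have hc : 0 < ε / (192 * (d + 1)) := by positivity
  have hlog := (Real.isLittleO_pow_log_id_atTop (n := 2)).bound hc
  have hx : Filter.Tendsto (fun n : ℕ => 2 * (n : ℝ) + 1) Filter.atTop Filter.atTop :=
    Filter.tendsto_atTop_add_const_right _ _
      (tendsto_natCast_atTop_atTop.const_mul_atTop two_pos)
  have hlin : ∀ᶠ n : ℕ in Filter.atTop, ((J : ℝ) + 1) / (ε / 4) ≤ n :=
    tendsto_natCast_atTop_atTop.eventually_ge_atTop _
  obtain ⟨N, hN⟩ := Filter.eventually_atTop.1
    (((hx.eventually hlog).and hlin).and (Filter.eventually_gt_atTop 0))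
  refine ⟨N, fun n hn => ?_⟩
  obtain ⟨⟨h1, h2⟩, h3⟩ := hN n hn
  refine ⟨h3, ?_⟩
  set l := Nat.log 2 (2 * n + 1) + 1 with hl
  have hlt : 2 * n + 1 < 2 ^ l := Nat.lt_pow_succ_log_self one_lt_two _
  have hn1 : (1 : ℝ) ≤ n := by exact_mod_cast h3
  have hlreal : (l : ℝ) ≤ 4 * Real.log (2 * n + 1) := by
    have ha : ((Nat.log 2 (2 * n + 1) : ℕ) : ℝ) ≤ Real.logb 2 ((2 * n + 1 : ℕ) : ℝ) :=
      Real.natLog_le_logb _ _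
    rw [Real.logb, le_div_iff₀ (Real.log_pos one_lt_two)] at ha
    push_cast at ha
    have h2 := Real.log_two_gt_d9
    have hb : Real.log 2 ≤ Real.log (2 * n + 1) := Real.log_le_log two_pos (by linarith)
    have hpos : (0 : ℝ) ≤ (Nat.log 2 (2 * n + 1) : ℕ) := by positivity
    rw [hl]
    push_cast
    nlinarith
  rw [id, Real.norm_of_nonneg (by positivity), Real.norm_of_nonneg (by positivity)] at h1
  have hmain : ((l * (d * l + 1) + J : ℕ) : ℝ) + 1 ≤ n * (ε / 2) := by
    have hl1 : (1 : ℝ) ≤ l := by exact_mod_cast Nat.succ_le_succ (Nat.zero_le _)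
    have hq : (l : ℝ) * (d * l + 1) ≤ (d + 1) * (l : ℝ) ^ 2 := by nlinarith
    have hq2 : (l : ℝ) ^ 2 ≤ 16 * Real.log (2 * n + 1) ^ 2 := by
      calc (l : ℝ) ^ 2 ≤ (4 * Real.log (2 * n + 1)) ^ 2 := by gcongr
        _ = _ := by ring
    have hq3 : (d + 1) * (16 * (ε / (192 * (d + 1)) * (2 * n + 1))) ≤ n * (ε / 4) := by
      have : ((d : ℝ) + 1) * (16 * (ε / (192 * (d + 1)) * (2 * n + 1))) = ε / 12 * (2 * n + 1) := by
        field_simp; ring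
      rw [this]
      nlinarith
    have hq4 : (d + 1) * (l : ℝ) ^ 2 ≤ (d + 1) * (16 * (ε / (192 * (d + 1)) * (2 * n + 1))) := by
      gcongr
      linarith
    have hq5 : (J : ℝ) + 1 ≤ n * (ε / 4) := (div_le_iff₀ (by positivity)).1 h2
    push_cast
    linarith
  refine ⟨d * l + 1, ⌊n * (ε / 2)⌋₊, ?_, Nat.floor_le (by positivity), ?_⟩
  · calc (2 * n + 1) ^ d ≤ (2 ^ l) ^ d := Nat.pow_le_pow_left hlt.le d
      _ = 2 ^ (d * l) := by rw [← pow_mul, mul_comm]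
      _ < _ := Nat.pow_lt_pow_right one_lt_two (Nat.lt_succ_self _)
  · have hk : l * (d * l + 1) + J ≤ ⌊n * (ε / 2)⌋₊ := Nat.le_floor (by linarith)
    rw [div_le_iff₀ (by positivity), div_le_iff₀ (by positivity)]
    calc (2 * n + 1 : ℝ) ^ (d * l + 1) ≤ ((2 : ℝ) ^ l) ^ (d * l + 1) := by
          gcongr
          exact_mod_cast hlt.le
      _ = (1 / 2) ^ J * 2 ^ (l * (d * l + 1) + J) := by
          rw [← pow_mul, pow_add, mul_left_comm, ← mul_pow]
          norm_num
      _ ≤ _ := by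
          gcongr
          norm_num

/-! ### Finite graph dimension suffices -/

section Learning

variable {X Y : Type*}

theorem exists_nat_bound_of_graphDim_lt_top {ℓ : Y → Y → ℝ≥0} {H : Set (X → Y)} {γ : ℝ}
    (h : graphDim ℓ H γ < ⊤) :
    ∃ d : ℕ, ∀ (n : ℕ) (x : Fin n → X), GraphShatters ℓ H γ x → n ≤ d := by
  obtain ⟨d, hd⟩ := ENat.ne_top_iff_exists.1 h.ne
  refine ⟨d, fun n x hx => ?_⟩
  have : (n : ℕ∞) ≤ graphDim ℓ H γ := le_iSup₂ (f := fun (n : ℕ) _ => (n : ℕ∞)) n ⟨x, hx⟩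
  rw [← hd] at this
  exact_mod_cast this

theorem exists_graphShatters_of_graphDim_eq_top {ℓ : Y → Y → ℝ≥0} {H : Set (X → Y)} {γ : ℝ}
    (h : graphDim ℓ H γ = ⊤) (n : ℕ) : ∃ m > n, ∃ x : Fin m → X, GraphShatters ℓ H γ x := by
  by_contra! hc
  have : graphDim ℓ H γ ≤ n := iSup₂_le fun m ⟨x, hx⟩ => by
    have : m ≤ n := not_lt.1 fun hm => hc m hm x hx
    exact_mod_cast this
  rw [h] at this
  exact absurd this (by simp)

open Classical in
/-- The partial concept comparing a hypothesis `h` with a target `g`: `some true` where the loss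
exceeds `γ`, `some false` where they agree, undefined elsewhere. -/
noncomputable def lossPattern (ℓ : Y → Y → ℝ≥0) (γ : ℝ) (g h : X → Y) (x : X) : Option Bool :=
  if γ < (ℓ (h x) (g x) : ℝ) then some true else if h x = g x then some false else none

theorem lossPattern_eq_true {ℓ : Y → Y → ℝ≥0} {γ : ℝ} {g h : X → Y} {x : X} :
    lossPattern ℓ γ g h x = some true ↔ γ < (ℓ (h x) (g x) : ℝ) := by
  unfold lossPattern
  split_ifs <;> simp_all

theorem lossPattern_eq_false {ℓ : Y → Y → ℝ≥0} (hℓ : ∀ y, ℓ y y = 0) {γ : ℝ} (hγ : 0 ≤ γ)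
    {g h : X → Y} {x : X} : lossPattern ℓ γ g h x = some false ↔ h x = g x := by
  unfold lossPattern
  split_ifs with h1 h2
  · simp only [Option.some.injEq, Bool.true_eq_false, false_iff]
    intro h2
    rw [h2, hℓ] at h1
    exact absurd h1 (not_lt.2 (by simpa using hγ))
  · simp [h2]
  · simp [h2]

/-- The loss patterns against a target in the class have a VC dimension bounded by the graph
dimension, as a set shattered by them is graph shattered with the labels of the target. -/
theorem card_le_of_partialShatters_lossPattern {ℓ : Y → Y → ℝ≥0} (hℓ : ∀ y, ℓ y y = 0) {γ : ℝ}
    (hγ : 0 ≤ γ) {T ι : Type*} {φ : T → X → Y} {d : ℕ}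
    (hd : ∀ (n : ℕ) (x : Fin n → X), GraphShatters ℓ (Set.range φ) γ x → n ≤ d) (s : T) (z : ι → X)
    (S : Finset ι)
    (hS : PartialShatters (Set.range fun t q => lossPattern ℓ γ (φ s) (φ t) (z q)) S) :
    S.card ≤ d := by
  classical
  refine hd S.card (fun i => z (S.equivFin.symm i)) ⟨fun i => φ s (z (S.equivFin.symm i)), ?_⟩
  intro b
  obtain ⟨_, ⟨t, rfl⟩, ht⟩ := hS fun q => if h : q ∈ S then b (S.equivFin ⟨q, h⟩) else false
  have ht' : ∀ i, lossPattern ℓ γ (φ s) (φ t) (z (S.equivFin.symm i)) = some (b i) := by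
    intro i
    simpa using ht _ (S.equivFin.symm i).2
  refine ⟨φ t, ⟨t, rfl⟩, fun i hi => ?_, fun i hi => ?_⟩
  · exact (lossPattern_eq_false hℓ hγ).1 (hi ▸ ht' i)
  · exact lossPattern_eq_true.1 (hi ▸ ht' i)

variable [MeasurableSpace X]

/-- Finite `γ`-graph dimension makes all ERMs succeed at the cut-off `γ`, with a common sample
size: the outputs of an ERM are consistent with the sample, so it fails only on samples for which
some consistent hypothesis has large error. -/
theorem exists_forall_cutoffPACGuarantee {ℓ : Y → Y → ℝ≥0} (hℓ : ∀ y, ℓ y y = 0)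
    {H : Set (X → Y)} (hH : IsAdmissible ℓ H) {γ : ℝ} (hγ : 0 ≤ γ) (hfin : graphDim ℓ H γ < ⊤)
    {ε δ : ℝ} (hε : 0 < ε) (hδ : 0 < δ) :
    ∃ N : ℕ, ∀ A : Learner X Y, IsERM H A → ∀ n ≥ N, CutoffPACGuarantee ℓ H A ε δ γ n := by
  obtain ⟨T, _, _, φ, rfl, hφ⟩ := hH
  obtain ⟨d, hd⟩ := exists_nat_bound_of_graphDim_lt_top hfin
  obtain ⟨N, hN⟩ := exists_sampleSize d hε hδ
  refine ⟨N, ?_⟩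
  rintro A hA n hn _ ⟨s, rfl⟩ D hD
  obtain ⟨hn0, L, k, hL, hk, hle⟩ := hN n hn
  have hp : ∀ y, MeasurableSet {q : T × X | lossPattern ℓ γ (φ s) (φ q.1) q.2 = some y} := by
    rintro (_ | _)
    · simp only [lossPattern_eq_false hℓ hγ]
      exact (hφ s).2
    · simp only [lossPattern_eq_true]
      exact measurableSet_lt measurable_const (hφ s).1.coe_nnreal_real
  refine le_trans (measure_mono fun x hx => ?_) ((measure_consistent_le D
    (fun t => lossPattern ℓ γ (φ s) (φ t)) hp hL
    (fun ω S => card_le_of_partialShatters_lossPattern hℓ hγ hd s (pairPoint ω) S) hε hn0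
    hk).trans (ENNReal.ofReal_le_ofReal hle))
  obtain ⟨⟨t, ht⟩, hfit⟩ := hA n (labelled (φ s) x) ⟨φ s, ⟨s, rfl⟩, fun i => rfl⟩
  refine ⟨t, fun i => (lossPattern_eq_false hℓ hγ).2 ?_, ?_⟩
  · rw [ht]
    exact hfit i
  · simp only [lossPattern_eq_true]
    rw [ht]
    exact (not_le.1 hx).le

/-! ### Finite graph dimension is necessary -/

/-- If the graph dimension is infinite, the ERM that receives a sample of size `n` from a shattered
set of more than `2 n` points may return a hypothesis that is wrong by more than `γ` at all points
outside the sample, hence on at least half of the shattered set. -/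
theorem exists_isERM_forall_not_cutoffPACGuarantee {ℓ : Y → Y → ℝ≥0} {H : Set (X → Y)} {γ : ℝ}
    (htop : graphDim ℓ H γ = ⊤) :
    ∃ A : Learner X Y, IsERM H A ∧ ∀ n, ¬ CutoffPACGuarantee ℓ H A (1 / 4) (1 / 2) γ n := by
  classical
  choose m hm x f g hgH hg0 hg1 using
    fun n : ℕ => exists_graphShatters_of_graphDim_eq_top htop (2 * n)
  let A : Learner X Y := fun n S =>
    if hc : ∃ j : Fin n → Fin (m n), ∀ i, S i = (x n (j i), f n (j i)) then
      g n fun i => decide (i ∉ Set.range hc.choose)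
    else if hr : ∃ h ∈ H, ∀ i, h (S i).1 = (S i).2 then hr.choose
    else g 0 fun _ => false
  refine ⟨A, fun n S hS => ?_, fun n hA => ?_⟩
  · by_cases hc : ∃ j : Fin n → Fin (m n), ∀ i, S i = (x n (j i), f n (j i))
    · simp only [A, dif_pos hc]
      refine ⟨hgH _ _, fun i => ?_⟩
      have h := hc.choose_spec i
      rw [h]
      exact hg0 n _ _ (by simp)
    · simp only [A, dif_neg hc, dif_pos hS]
      exact hS.choose_spec
  · have hm0 : (m n : ℝ≥0∞) ≠ 0 := by
      have := hm n
      exact_mod_cast (by omega : m n ≠ 0)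
    let U : Measure (Fin (m n)) := (m n : ℝ≥0∞)⁻¹ • Measure.count
    have hU : IsProbabilityMeasure U := ⟨by
      simp [U, ENNReal.inv_mul_cancel hm0 (ENNReal.natCast_ne_top _)]⟩
    have hx : Measurable (x n) := measurable_of_countable _
    have hD : IsProbabilityMeasure (U.map (x n)) := Measure.isProbabilityMeasure_map hx.aemeasurable
    have hbad := hA (g n fun _ => false) (hgH _ _) _ hD
    have hmap : Measure.pi (fun _ : Fin n => U.map (x n)) =
        (Measure.pi fun _ : Fin n => U).map fun j i => x n (j i) :=
      (Measure.pi_map_pi fun _ => hx.aemeasurable).symm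
    -- passing to the indices of the shattered points avoids assuming measurable singletons in `X`
    rw [hmap] at hbad
    have hxm : Measurable fun (j : Fin n → Fin (m n)) i => x n (j i) := measurable_of_countable _
    have hone := (Measure.le_map_apply hxm.aemeasurable _).trans hbad
    rw [Set.eq_univ_of_forall (s := (fun (j : Fin n → Fin (m n)) i => x n (j i)) ⁻¹' _),
      measure_univ] at hone
    · rw [← ENNReal.ofReal_one, ENNReal.ofReal_le_ofReal_iff (by norm_num)] at hone
      norm_num at hone
    intro j hj
    have hlab : ∃ j' : Fin n → Fin (m n), ∀ i,
        labelled (g n fun _ => false) (fun i => x n (j i)) i = (x n (j' i), f n (j' i)) :=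
      ⟨j, fun i => Prod.ext rfl (hg0 n _ _ rfl)⟩
    set j' := hlab.choose with hj'
    have hAeq : A n (labelled (g n fun _ => false) fun i => x n (j i)) =
        g n fun i => decide (i ∉ Set.range j') := by
      simp only [A, dif_pos hlab, hj']
    rw [hAeq] at hj
    have hlow := (Measure.le_map_apply hx.aemeasurable _).trans hj
    set R : Finset (Fin (m n)) := Finset.univ.filter fun i => i ∉ Set.range j' with hR
    have hRsub : (R : Set (Fin (m n))) ⊆ x n ⁻¹' {z | γ < (ℓ (g n (fun i => decide
        (i ∉ Set.range j')) z) (g n (fun _ => false) z) : ℝ)} := by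
      intro i hi
      have hi' : i ∉ Set.range j' := by simpa [hR] using hi
      have h1 := hg1 n (fun i => decide (i ∉ Set.range j')) i (by simpa using hi')
      rw [← hg0 n (fun _ => false) i rfl] at h1
      exact h1
    have hRcard : m n ≤ R.card + n := by
      have h1 : Rᶜ ⊆ Finset.univ.image j' := by
        intro i hi
        simpa [hR] using hi
      have h2 := (Finset.card_le_card h1).trans Finset.card_image_le
      rw [Finset.card_compl] at h2
      simp only [Fintype.card_fin, Finset.card_univ] at h2
      omega
    have hfinal := (measure_mono hRsub).trans hlow
    have hmn := hm n
    simp only [U, Measure.smul_apply, smul_eq_mul, Measure.count_apply_finset] at hfinal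
    rw [mul_comm, ← div_eq_mul_inv, ENNReal.div_le_iff hm0 (ENNReal.natCast_ne_top _),
      ← ENNReal.ofReal_natCast, ← ENNReal.ofReal_natCast, ← ENNReal.ofReal_mul (by norm_num),
      ENNReal.ofReal_le_ofReal_iff (by positivity)] at hfinal
    have h4 : (R.card : ℝ) * 4 ≤ m n := by linarith
    have h4' : R.card * 4 ≤ m n := by exact_mod_cast h4
    omega

/-! ### Expected loss and cut-off loss -/

theorem IsAdmissible.measurable_loss {ℓ : Y → Y → ℝ≥0} {H : Set (X → Y)} (hH : IsAdmissible ℓ H)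
    {g h : X → Y} (hg : g ∈ H) (hh : h ∈ H) : Measurable fun x => ℓ (g x) (h x) := by
  obtain ⟨T, _, _, φ, rfl, hφ⟩ := hH
  obtain ⟨t, rfl⟩ := hg
  obtain ⟨s, rfl⟩ := hh
  exact (hφ s).1.comp measurable_prodMk_left

/-- Markov's inequality. -/
theorem PACGuarantee.cutoff {ℓ : Y → Y → ℝ≥0} {H : Set (X → Y)} (hH : IsAdmissible ℓ H)
    {A : Learner X Y} (hA : IsERM H A) {ε δ γ : ℝ} (hγ : 0 < γ) {n : ℕ}
    (h : PACGuarantee ℓ H A (ε * γ) δ n) : CutoffPACGuarantee ℓ H A ε δ γ n := by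
  intro g hg D hD
  refine (measure_mono fun x hx => ?_).trans (h g hg D hD)
  intro hle
  refine hx ?_
  have hAH := (hA n (labelled g x) ⟨g, hg, fun i => rfl⟩).1
  have hm := (hH.measurable_loss hAH hg).coe_nnreal_ennreal
  have hmarkov := (mul_meas_ge_le_lintegral (μ := D) hm (ENNReal.ofReal γ)).trans hle
  rw [mul_comm ε, ENNReal.ofReal_mul hγ.le,
    ENNReal.mul_le_mul_iff_right (by simpa using hγ) ENNReal.ofReal_ne_top] at hmarkov
  refine (measure_mono fun z hz => ?_).trans hmarkov
  have hz' : γ ≤ (ℓ (A n (labelled g x) z) (g z) : ℝ) := le_of_lt hz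
  exact (ENNReal.ofReal_le_ofReal hz').trans_eq (ENNReal.ofReal_coe_nnreal)

/-- For a loss bounded by `B`, the expected loss is at most `γ + B * P (loss > γ)`. -/
theorem CutoffPACGuarantee.pac {ℓ : Y → Y → ℝ≥0} {H : Set (X → Y)} (hH : IsAdmissible ℓ H)
    {B : ℝ≥0} (hB : ∀ y₁ y₂, ℓ y₁ y₂ ≤ B) {A : Learner X Y} (hA : IsERM H A) {ε ε' δ γ : ℝ}
    (hγ : 0 ≤ γ) (hε' : 0 ≤ ε') (hε : γ + B * ε' ≤ ε) {n : ℕ}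
    (h : CutoffPACGuarantee ℓ H A ε' δ γ n) : PACGuarantee ℓ H A ε δ n := by
  intro g hg D hD
  refine (measure_mono fun x hx => ?_).trans (h g hg D hD)
  intro hle
  refine hx ?_
  have hAH := (hA n (labelled g x) ⟨g, hg, fun i => rfl⟩).1
  have hm := (hH.measurable_loss hAH hg).coe_nnreal_real
  set E := {z | γ < (ℓ (A n (labelled g x) z) (g z) : ℝ)} with hE
  have hEm : MeasurableSet E := measurableSet_lt measurable_const hm
  calc ∫⁻ z, (ℓ (A n (labelled g x) z) (g z) : ℝ≥0∞) ∂D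
      ≤ ∫⁻ z, (ENNReal.ofReal γ + B * E.indicator 1 z) ∂D := lintegral_mono fun z => ?_
    _ = ENNReal.ofReal γ + B * D E := by
        rw [lintegral_add_left measurable_const,
          lintegral_const_mul _ (measurable_one.indicator hEm), lintegral_indicator_one hEm]
        simp
    _ ≤ ENNReal.ofReal γ + B * ENNReal.ofReal ε' := by gcongr
    _ = ENNReal.ofReal (γ + B * ε') := by
        rw [ENNReal.ofReal_add hγ (by positivity), ENNReal.ofReal_mul (by positivity),
          ENNReal.ofReal_coe_nnreal]
    _ ≤ _ := ENNReal.ofReal_le_ofReal hε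
  by_cases hz : z ∈ E
  · simp only [Set.indicator_of_mem hz, Pi.one_apply, mul_one]
    exact le_add_left (by exact_mod_cast hB _ _)
  · have hz' : (ℓ (A n (labelled g x) z) (g z) : ℝ) ≤ γ := not_lt.1 hz
    exact le_add_right (ENNReal.ofReal_coe_nnreal.symm.trans_le (ENNReal.ofReal_le_ofReal hz'))

end Learning

theorem mainTheorem7 {X Y : Type*} [MeasurableSpace X] (c : ℝ≥0) (ℓ : Y → Y → ℝ≥0)
    (hℓ : IsApproxPseudoMetric c ℓ) (H : Set (X → Y)) (hH : IsAdmissible ℓ H) :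
    -- cut-off learnability, for every loss: each ERM learns, also uniformly over all ERMs
    [∀ A : Learner X Y, IsERM H A → IsCutoffPACLearner ℓ H A,
      ∀ ε ∈ Set.Ioo (0 : ℝ) 1, ∀ δ ∈ Set.Ioo (0 : ℝ) 1, ∀ γ ∈ Set.Ioo (0 : ℝ) 1,
        ∃ N : ℕ, ∀ A : Learner X Y, IsERM H A → ∀ n ≥ N, CutoffPACGuarantee ℓ H A ε δ γ n,
      ∀ γ ∈ Set.Ioo (0 : ℝ) 1, graphDim ℓ H γ < ⊤].TFAE ∧
    -- learnability in expected loss, necessity for every loss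
    ((∀ A : Learner X Y, IsERM H A → IsPACLearner ℓ H A) →
      ∀ γ ∈ Set.Ioo (0 : ℝ) 1, graphDim ℓ H γ < ⊤) ∧
    -- learnability in expected loss, full characterization for bounded losses
    ((∃ B : ℝ≥0, ∀ y₁ y₂, ℓ y₁ y₂ ≤ B) →
      [∀ A : Learner X Y, IsERM H A → IsPACLearner ℓ H A,
        ∀ ε ∈ Set.Ioo (0 : ℝ) 1, ∀ δ ∈ Set.Ioo (0 : ℝ) 1,
          ∃ N : ℕ, ∀ A : Learner X Y, IsERM H A → ∀ n ≥ N, PACGuarantee ℓ H A ε δ n,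
        ∀ γ ∈ Set.Ioo (0 : ℝ) 1, graphDim ℓ H γ < ⊤].TFAE) := by
  have necessary : (∀ A : Learner X Y, IsERM H A → IsCutoffPACLearner ℓ H A) →
      ∀ γ ∈ Set.Ioo (0 : ℝ) 1, graphDim ℓ H γ < ⊤ := by
    intro h γ hγ
    by_contra hc
    obtain ⟨A, hA, hbad⟩ := exists_isERM_forall_not_cutoffPACGuarantee (not_lt_top_iff.1 hc)
    obtain ⟨N, hN⟩ := h A hA (1 / 4) (by norm_num) (1 / 2) (by norm_num) γ hγ
    exact hbad N (hN N le_rfl)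
  have sufficient : (∀ γ ∈ Set.Ioo (0 : ℝ) 1, graphDim ℓ H γ < ⊤) →
      ∀ ε ∈ Set.Ioo (0 : ℝ) 1, ∀ δ ∈ Set.Ioo (0 : ℝ) 1, ∀ γ ∈ Set.Ioo (0 : ℝ) 1,
        ∃ N : ℕ, ∀ A : Learner X Y, IsERM H A → ∀ n ≥ N, CutoffPACGuarantee ℓ H A ε δ γ n :=
    fun h ε hε δ hδ γ hγ =>
      exists_forall_cutoffPACGuarantee hℓ.self hH hγ.1.le (h γ hγ) hε.1 hδ.1
  have necessary' : (∀ A : Learner X Y, IsERM H A → IsPACLearner ℓ H A) →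
      ∀ γ ∈ Set.Ioo (0 : ℝ) 1, graphDim ℓ H γ < ⊤ := by
    intro h
    refine necessary fun A hA ε hε δ hδ γ hγ => ?_
    obtain ⟨N, hN⟩ := h A hA (ε * γ) ⟨mul_pos hε.1 hγ.1, mul_lt_one_of_nonneg_of_lt_one_left hε.1.le
      hε.2 hγ.2.le⟩ δ hδ
    exact ⟨N, fun n hn => (hN n hn).cutoff hH hA hγ.1⟩
  refine ⟨?_, necessary', ?_⟩
  · tfae_have 2 → 1 := fun h A hA ε hε δ hδ γ hγ =>
      let ⟨N, hN⟩ := h ε hε δ hδ γ hγ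
      ⟨N, hN A hA⟩
    tfae_have 1 → 3 := necessary
    tfae_have 3 → 2 := sufficient
    tfae_finish
  · rintro ⟨B, hB⟩
    tfae_have 2 → 1 := fun h A hA ε hε δ hδ =>
      let ⟨N, hN⟩ := h ε hε δ hδ
      ⟨N, hN A hA⟩
    tfae_have 1 → 3 := necessary'
    tfae_have 3 → 2 := by
      intro h ε hε δ hδ
      have hB0 : (0 : ℝ) < 2 * (B + 1) := by positivity
      have hBe : ε / (2 * (B + 1)) < 1 := by
        rw [div_lt_one hB0]
        linarith [hε.2, B.2]
      obtain ⟨N, hN⟩ := sufficient h (ε / (2 * (B + 1))) ⟨div_pos hε.1 hB0, hBe⟩ δ hδ (ε / 2)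
        ⟨half_pos hε.1, by linarith [hε.1, hε.2]⟩
      refine ⟨N, fun A hA n hn => (hN A hA n hn).pac hH hB hA (half_pos hε.1).le
        (div_pos hε.1 hB0).le ?_⟩
      have : (B : ℝ) * (ε / (2 * (B + 1))) ≤ ε / 2 := by
        rw [mul_div_assoc', div_le_div_iff₀ hB0 two_pos]
        nlinarith [hε.1, B.2]
      linarith
    tfae_finish
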